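/- For a finite graph $G=(V,E)$ let $i(G)$ be the number of independent sets of $G$ (including the empty set), and let its average degree be $\frac{1}{|V|}\sum_{v\in V}\deg(v)$. Let $W$ be the Lambert $W$ function on $\mathbb{R}_{\ge 0}$, that is, the inverse of the function $\mathbb{R}_{\ge 0}\to\mathbb{R}_{\ge 0}$, $x\mapsto xe^x$. Let $\mathcal{F}_1:\mathbb{R}_{\ge 0}\to\mathbb{R}_{\ge 0}$ be defined by \[\mathcal{F}_1(d)=\inf\left\{\frac{\log i(G)}{|V|} : G=(V,E)\text{ a finite triangle-free graph with } V\neq\varnothing \text{ and average degree at most } d\right\}.\] Then for all $d\ge 0$ \[\frac{W(d)^2+2W(d)-W(2)^2-2W(2)}{2(d-2)}\le \mathcal{F}_1(d)\le\frac{W(d)^2+2W(d)}{2d},\] where the left-hand side at $d=2$ and the right-hand side at $d=0$, which formally read $0/0$, are understood as the values of the continuous extensions to $[0,\infty)$, namely $W(2)/2$ and $1$, respectively. -/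

import Mathlib

/-- The Lambert `W` function on the nonnegative reals: the inverse of the map `x ↦ x * exp x`
from `[0, ∞)` to `[0, ∞)` (arguments below `0` are never used). -/
noncomputable def lambertW (y : ℝ) : ℝ :=
  Function.invFunOn (fun x : ℝ => x * Real.exp x) (Set.Ici 0) y

/-- For `y ≥ 0`, `lambertW y` is a nonnegative solution `x` of `x * exp x = y`. -/
theorem lambertW_spec {y : ℝ} (hy : 0 ≤ y) :
    0 ≤ lambertW y ∧ lambertW y * Real.exp (lambertW y) = y := by
  have hex : ∃ x ∈ Set.Ici (0 : ℝ), (fun x : ℝ => x * Real.exp x) x = y := by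
    have hcont : ContinuousOn (fun x : ℝ => x * Real.exp x) (Set.Icc 0 y) := by fun_prop
    have hle : y ≤ y * Real.exp y :=
      le_mul_of_one_le_right hy (Real.one_le_exp hy)
    obtain ⟨x, hx, hxy⟩ := intermediate_value_Icc hy hcont
      (show y ∈ Set.Icc ((fun x : ℝ => x * Real.exp x) 0) ((fun x : ℝ => x * Real.exp x) y) from
        ⟨by simpa using hy, hle⟩)
    exact ⟨x, hx.1, hxy⟩
  exact ⟨Function.invFunOn_mem hex, Function.invFunOn_eq hex⟩

/-- `lambertW` is a left inverse of `x ↦ x * exp x` on `[0, ∞)`. -/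
theorem lambertW_mul_exp {x : ℝ} (hx : 0 ≤ x) : lambertW (x * Real.exp x) = x := by
  obtain ⟨h0, h1⟩ := lambertW_spec (mul_nonneg hx (Real.exp_pos x).le)
  have key : ∀ a b : ℝ, 0 ≤ a → a < b → a * Real.exp a < b * Real.exp b := fun a b ha hab =>
    mul_lt_mul hab (Real.exp_le_exp.2 hab.le) (Real.exp_pos a) (ha.trans hab.le)
  rcases lt_trichotomy (lambertW (x * Real.exp x)) x with h | h | h
  · exact absurd h1 (key _ _ h0 h).ne
  · exact h
  · exact absurd h1 (key _ _ hx h).ne'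

open Classical in
/-- The average degree `(1 / |V|) * ∑ v, deg v` of a finite graph (it is `0` if `V` is empty). -/
noncomputable def avgDegree {V : Type} [Fintype V] (G : SimpleGraph V) : ℝ :=
  (∑ v : V, (G.degree v : ℝ)) / (Fintype.card V : ℝ)

open Classical in
/-- The number of independent sets of a finite graph, the empty set included. -/
noncomputable def numIndepSets {V : Type} [Fintype V] (G : SimpleGraph V) : ℕ :=
  (Finset.univ.filter fun s : Finset V => G.IsIndepSet (s : Set V)).card

/-- The values `log (i(G)) / |V|`, where `G` runs over the finite triangle-free graphs with at
least one vertex and average degree at most `d`. -/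
def logIndepDensities (d : ℝ) : Set ℝ :=
  {x | ∃ (V : Type) (_ : Fintype V) (_ : Nonempty V) (G : SimpleGraph V),
    G.CliqueFree 3 ∧ avgDegree G ≤ d ∧
      x = Real.log (numIndepSets G) / (Fintype.card V : ℝ)}

/-- The extremal function `F₁`. -/
noncomputable def extremalF (d : ℝ) : ℝ := sInf (logIndepDensities d)

/-- For `d ≥ 0` the infimum is over a nonempty set. -/
theorem logIndepDensities_nonempty {d : ℝ} (hd : 0 ≤ d) : (logIndepDensities d).Nonempty := by
  refine ⟨_, Fin 1, inferInstance, inferInstance, ⊥, ?_, ?_, rfl⟩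
  · exact SimpleGraph.cliqueFree_bot (by norm_num)
  · simpa [avgDegree] using hd

/-- The infimum is over a set that is bounded below by `0`. -/
theorem logIndepDensities_nonneg {d x : ℝ} (hx : x ∈ logIndepDensities d) : 0 ≤ x := by
  obtain ⟨V, _, _, G, -, -, rfl⟩ := hx
  exact div_nonneg (Real.log_natCast_nonneg _) (Nat.cast_nonneg _)

/-- The lower curve. At `d = 2`, where the quotient reads `0 / 0`, it has the value of the
continuous extension. -/
noncomputable def lowerCurve (d : ℝ) : ℝ :=
  if d = 2 then lambertW 2 / 2
  else (lambertW d ^ 2 + 2 * lambertW d - lambertW 2 ^ 2 - 2 * lambertW 2) / (2 * (d - 2))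

/-- The upper curve. At `d = 0`, where the quotient reads `0 / 0`, it has the value of the
continuous extension. -/
noncomputable def upperCurve (d : ℝ) : ℝ :=
  if d = 0 then 1
  else (lambertW d ^ 2 + 2 * lambertW d) / (2 * d)

/-! Write x(t) = W(t)/t = exp(-W(t)), so exp(-t x) = x; an antiderivative of x is W²/2 + W.

Lower bound. The curve f(d) is the mean of x between 2 and d. It is convex and decreasing, and f +
(d-2)f' = x. Induction on S gives log i(G[S]) ≥ |S| f(d), with d the average degree of G[S]: delete
v, or v together with N(v), and bound both pieces by the tangent of f at d. In a triangle-free graph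
N(v) is independent, so the edges lost are counted exactly by degree sums. Averaging over v, with
convexity of exp and ∑ deg² ≥ |S| d², leaves a one-variable inequality (`one_le_exp_add_exp`). By
the differential equation it becomes x + 2f' ≤ log(1 + x), which is `two_mul_meanExpNegWDeriv_le`.

Upper bound. Choose about dn/2 random pairs in turn, joining each when this creates no triangle and
no degree above D. Almost all pairs are admissible, so a k-set stays independent with probability at
most about (1 - k²/n²)^(dn/2). Summing over all sets gives exp(n(x + dx²/2 + o(1))). The choices are
derandomized by a weight whose average does not grow. -/

/-! ### Calculus of the Lambert function. -/

/-- The function `lambertW`, extended to the negative reals by `0`. -/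
noncomputable def clampedW (t : ℝ) : ℝ := lambertW (max t 0)

theorem clampedW_nonneg (t : ℝ) : 0 ≤ clampedW t := (lambertW_spec (le_max_right t 0)).1

theorem clampedW_mul_exp {t : ℝ} (ht : 0 ≤ t) : clampedW t * Real.exp (clampedW t) = t := by
  simpa only [clampedW, max_eq_left ht] using (lambertW_spec ht).2

theorem clampedW_of_nonneg {t : ℝ} (ht : 0 ≤ t) : clampedW t = lambertW t := by
  rw [clampedW, max_eq_left ht]

/-- The map x ↦ x exp x has slope at least 1 on [0, ∞). This makes its inverse monotone and
1-Lipschitz. -/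
theorem sub_le_mul_exp_sub {a b : ℝ} (ha : 0 ≤ a) (hab : a ≤ b) :
    b - a ≤ b * Real.exp b - a * Real.exp a := by
  have h1 := Real.exp_le_exp.2 hab
  have h2 := Real.one_le_exp (ha.trans hab)
  nlinarith [mul_le_mul_of_nonneg_left h1 ha, mul_nonneg (sub_nonneg.2 hab) (sub_nonneg.2 h2)]

theorem lambertW_mono {a b : ℝ} (ha : 0 ≤ a) (hab : a ≤ b) : lambertW a ≤ lambertW b := by
  by_contra! h
  obtain ⟨hb0, hb⟩ := lambertW_spec (ha.trans hab)
  obtain ⟨ha0, haa⟩ := lambertW_spec ha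
  have := sub_le_mul_exp_sub hb0 h.le
  linarith

theorem continuous_clampedW : Continuous clampedW := by
  have hlip : LipschitzOnWith 1 lambertW (Set.Ici 0) := by
    apply LipschitzOnWith.of_le_add_mul
    intro x hx y hy
    rw [NNReal.coe_one, one_mul]
    obtain ⟨hx0, hxx⟩ := lambertW_spec (Set.mem_Ici.1 hx)
    obtain ⟨hy0, hyy⟩ := lambertW_spec (Set.mem_Ici.1 hy)
    rcases le_total x y with h | h
    · linarith [lambertW_mono hx h, dist_nonneg (x := x) (y := y)]
    · have h1 := sub_le_mul_exp_sub hy0 (lambertW_mono hy h)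
      rw [hxx, hyy] at h1
      linarith [Real.dist_eq x y, le_abs_self (x - y)]
  exact hlip.continuousOn.comp_continuous (by fun_prop) fun x => le_max_right x 0

theorem hasDerivAt_clampedW {t : ℝ} (ht : 0 < t) :
    HasDerivAt clampedW (Real.exp (-clampedW t) / (1 + clampedW t)) t := by
  have hW := clampedW_nonneg t
  have h1 : HasDerivAt (fun x : ℝ => x * Real.exp x)
      ((1 + clampedW t) * Real.exp (clampedW t)) (clampedW t) := by
    convert! (hasDerivAt_id (clampedW t)).mul (Real.hasDerivAt_exp (clampedW t)) using 1
    simp; ring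
  have h2 : (1 + clampedW t) * Real.exp (clampedW t) ≠ 0 := by positivity
  convert! HasDerivAt.of_local_left_inverse continuous_clampedW.continuousAt h1 h2 ?_ using 1
  · rw [Real.exp_neg]; field_simp
  · filter_upwards [lt_mem_nhds ht] with y hy using clampedW_mul_exp hy.le

/-! ### The function W(t)/t and its convexity. -/

/-- The function `t ↦ W(t) / t`, continuously extended to the real line. -/
noncomputable def expNegW (t : ℝ) : ℝ := Real.exp (-clampedW t)

/-- The derivative of `expNegW` on the positive reals. -/
noncomputable def expNegWDeriv (t : ℝ) : ℝ :=
  -(expNegW t ^ 2 / (1 + clampedW t))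

theorem expNegW_pos (t : ℝ) : 0 < expNegW t := Real.exp_pos _

theorem continuous_expNegW : Continuous expNegW := by
  have := continuous_clampedW
  unfold expNegW
  fun_prop

theorem continuous_expNegWDeriv : Continuous expNegWDeriv := by
  have := continuous_clampedW
  have := continuous_expNegW
  unfold expNegWDeriv
  refine Continuous.neg (Continuous.div (by fun_prop) (by fun_prop) fun t => ?_)
  linarith [clampedW_nonneg t]

theorem clampedW_eq_mul_expNegW {t : ℝ} (ht : 0 ≤ t) : clampedW t = t * expNegW t := by
  have h := clampedW_mul_exp ht
  rw [expNegW, Real.exp_neg]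
  field_simp
  exact h

theorem exp_neg_mul_expNegW {t : ℝ} (ht : 0 ≤ t) : Real.exp (-(t * expNegW t)) = expNegW t := by
  rw [← clampedW_eq_mul_expNegW ht, expNegW]

theorem hasDerivAt_expNegW {t : ℝ} (ht : 0 < t) : HasDerivAt expNegW (expNegWDeriv t) t := by
  convert! (hasDerivAt_clampedW ht).neg.exp using 1
  simp only [expNegWDeriv, expNegW, Pi.neg_apply]
  ring

/-- Convexity of W(t)/t in tangent form. Substituting a = α exp α, b = (α + r) exp(α + r) avoids
second derivatives and reduces it to an elementary inequality in α and r. -/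
theorem expNegW_tangent {a b : ℝ} (ha : 0 ≤ a) (hb : 0 ≤ b) :
    expNegW a + expNegWDeriv a * (b - a) ≤ expNegW b := by
  have hA := clampedW_nonneg a
  have hB := clampedW_nonneg b
  have ea := clampedW_mul_exp ha
  have eb := clampedW_mul_exp hb
  unfold expNegWDeriv expNegW
  generalize clampedW a = α at *
  generalize clampedW b = β at *
  subst ea eb
  set r := β - α with hr
  have hβ : β = α + r := by rw [hr]; ring
  clear_value r
  subst hβ
  rw [neg_add, Real.exp_add, Real.exp_add]
  have hEp := Real.exp_pos (-α)
  have hE : Real.exp α * Real.exp (-α) = 1 := by rw [← Real.exp_add]; simp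
  have hR : Real.exp r * Real.exp (-r) = 1 := by rw [← Real.exp_add]; simp
  have hRp := Real.exp_pos (-r)
  have hRq := Real.exp_pos r
  -- The difference of the sides is α(e^r + e^(-r) - 2) + (e^(-r) + r - 1) + r(e^r - 1), a sum of
  -- nonnegative terms.
  have h1 : 1 + 2 * α ≤ (1 + α) * Real.exp (-r) + (α + r) * Real.exp r := by
    have i1 : 2 ≤ Real.exp r + Real.exp (-r) := by
      nlinarith [sq_nonneg (Real.exp r - Real.exp (-r))]
    have i2 : -r + 1 ≤ Real.exp (-r) := Real.add_one_le_exp (-r)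
    have i3 : 0 ≤ r * (Real.exp r - 1) := by
      rcases le_total 0 r with h | h
      · exact mul_nonneg h (sub_nonneg.2 (Real.one_le_exp h))
      · exact mul_nonneg_of_nonpos_of_nonpos h (sub_nonpos.2 (Real.exp_le_one_iff.2 h))
    nlinarith [mul_nonneg hA (sub_nonneg.2 i1)]
  have h2 : Real.exp (-α) + -(Real.exp (-α) ^ 2 / (1 + α)) *
      ((α + r) * (Real.exp α * Real.exp r) - α * Real.exp α)
      = Real.exp (-α) * (1 + 2 * α - (α + r) * Real.exp r) / (1 + α) := by
    field_simp
    linear_combination (α - (α + r) * Real.exp r) * hE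
  rw [h2, div_le_iff₀ (by positivity), mul_assoc]
  exact mul_le_mul_of_nonneg_left (by linarith) hEp.le

theorem hasDerivAt_clampedW_sq {t : ℝ} (ht : 0 < t) :
    HasDerivAt (fun t => clampedW t ^ 2 / 2 + clampedW t) (expNegW t) t := by
  have h := hasDerivAt_clampedW ht
  have hW := clampedW_nonneg t
  convert! ((h.pow 2).div_const 2).add h using 1
  rw [expNegW]
  field_simp
  push_cast
  ring

/-! ### The lower curve as a mean, with its differential equation. -/

/-- The mean of `expNegW` over the interval between `2` and `d`. -/
noncomputable def meanExpNegW (d : ℝ) : ℝ := ∫ s in (0 : ℝ)..1, expNegW (2 + s * (d - 2))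

/-- The derivative of `meanExpNegW`. -/
noncomputable def meanExpNegWDeriv (d : ℝ) : ℝ :=
  ∫ s in (0 : ℝ)..1, s * expNegWDeriv (2 + s * (d - 2))

theorem continuous_meanExpNegW : Continuous meanExpNegW := by
  have := continuous_expNegW
  unfold meanExpNegW
  exact intervalIntegral.continuous_parametric_intervalIntegral_of_continuous' (by fun_prop) 0 1

theorem segment_nonneg {d s : ℝ} (hd : 0 ≤ d) (h0 : 0 ≤ s) (h1 : s ≤ 1) :
    0 ≤ 2 + s * (d - 2) := by nlinarith

/-- The integrand on the left is the s-derivative of s · x(2 + s(d-2)). The integral form also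
covers d = 2. -/
theorem meanExpNegW_add_mul {d : ℝ} (hd : 0 ≤ d) :
    meanExpNegW d + (d - 2) * meanExpNegWDeriv d = expNegW d := by
  have c1 := continuous_expNegW
  have c2 := continuous_expNegWDeriv
  have h := intervalIntegral.integral_eq_sub_of_hasDerivAt_of_le (zero_le_one' ℝ)
    (f := fun s => s * expNegW (2 + s * (d - 2)))
    (f' := fun s => expNegW (2 + s * (d - 2)) + (d - 2) * (s * expNegWDeriv (2 + s * (d - 2))))
    (by fun_prop) (fun s hs => by
      have hpos : 0 < 2 + s * (d - 2) := by nlinarith [hs.1, hs.2]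
      have hlin : HasDerivAt (fun s : ℝ => 2 + s * (d - 2)) (d - 2) s := by
        simpa using ((hasDerivAt_id s).mul_const (d - 2)).const_add 2
      convert! (hasDerivAt_id s).mul ((hasDerivAt_expNegW hpos).comp s hlin) using 1
      simp
      ring)
    (Continuous.intervalIntegrable (by fun_prop) 0 1)
  rw [intervalIntegral.integral_add (Continuous.intervalIntegrable (by fun_prop) 0 1)
    (Continuous.intervalIntegrable (by fun_prop) 0 1), intervalIntegral.integral_const_mul] at h
  rw [meanExpNegW, meanExpNegWDeriv, h]
  simp

theorem mul_meanExpNegW {d : ℝ} (hd : 0 ≤ d) : (d - 2) * meanExpNegW d =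
    (clampedW d ^ 2 / 2 + clampedW d) - (clampedW 2 ^ 2 / 2 + clampedW 2) := by
  have c1 := continuous_expNegW
  have c2 := continuous_clampedW
  have h := intervalIntegral.integral_eq_sub_of_hasDerivAt_of_le (zero_le_one' ℝ)
    (f := fun s => clampedW (2 + s * (d - 2)) ^ 2 / 2 + clampedW (2 + s * (d - 2)))
    (f' := fun s => (d - 2) * expNegW (2 + s * (d - 2)))
    (by fun_prop) (fun s hs => by
      have hpos : 0 < 2 + s * (d - 2) := by nlinarith [hs.1, hs.2]
      have hlin : HasDerivAt (fun s : ℝ => 2 + s * (d - 2)) (d - 2) s := by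
        simpa using ((hasDerivAt_id s).mul_const (d - 2)).const_add 2
      convert! (hasDerivAt_clampedW_sq hpos).comp s hlin using 1
      ring)
    (Continuous.intervalIntegrable (by fun_prop) 0 1)
  rw [intervalIntegral.integral_const_mul] at h
  rw [meanExpNegW, h]
  simp

/-- Convexity passes to the mean: integrate the tangent inequality for `expNegW` over s. -/
theorem meanExpNegW_tangent {d t : ℝ} (hd : 0 ≤ d) (ht : 0 ≤ t) :
    meanExpNegW d + meanExpNegWDeriv d * (t - d) ≤ meanExpNegW t := by
  have c1 := continuous_expNegW
  have c2 := continuous_expNegWDeriv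
  unfold meanExpNegW meanExpNegWDeriv
  rw [← intervalIntegral.integral_mul_const, ← intervalIntegral.integral_add
    (Continuous.intervalIntegrable (by fun_prop) 0 1)
    (Continuous.intervalIntegrable (by fun_prop) 0 1)]
  refine intervalIntegral.integral_mono_on (zero_le_one' ℝ)
    (Continuous.intervalIntegrable (by fun_prop) 0 1)
    (Continuous.intervalIntegrable (by fun_prop) 0 1) fun s hs => ?_
  have := expNegW_tangent (segment_nonneg hd hs.1 hs.2) (segment_nonneg ht hs.1 hs.2)
  linarith

theorem expNegWDeriv_nonpos (t : ℝ) : expNegWDeriv t ≤ 0 := by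
  have := clampedW_nonneg t
  rw [expNegWDeriv, neg_nonpos]
  positivity

theorem meanExpNegWDeriv_nonpos (d : ℝ) : meanExpNegWDeriv d ≤ 0 := by
  have h : 0 ≤ ∫ s in (0 : ℝ)..1, -(s * expNegWDeriv (2 + s * (d - 2))) :=
    intervalIntegral.integral_nonneg (zero_le_one' ℝ) fun s hs => by
      nlinarith [hs.1, expNegWDeriv_nonpos (2 + s * (d - 2))]
  rw [intervalIntegral.integral_neg] at h
  rw [meanExpNegWDeriv]
  linarith

theorem meanExpNegW_anti {t d : ℝ} (ht : 0 ≤ t) (htd : t ≤ d) : meanExpNegW d ≤ meanExpNegW t := by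
  have h1 := meanExpNegW_tangent (ht.trans htd) ht
  nlinarith [meanExpNegWDeriv_nonpos d]

/-! ### The analytic inequality behind the lower bound. -/

theorem sub_log_one_add_le {x : ℝ} (hx : 0 ≤ x) : x - Real.log (1 + x) ≤ x ^ 2 / (x + 2) := by
  have h := Real.le_log_one_add_of_nonneg hx
  have : x ^ 2 / (x + 2) = x - 2 * x / (x + 2) := by field_simp; ring
  linarith

/-- An auxiliary function, minimal on the nonnegative reals at `lambertW 2`; its minimality bounds
`meanExpNegWDeriv` from above. -/
noncomputable def gapFun (w : ℝ) : ℝ :=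
  w ^ 2 + 4 * Real.exp (-w) -
    (Real.exp (-w) - Real.log (1 + Real.exp (-w))) * (w * Real.exp w - 2) ^ 2

theorem hasDerivAt_gapFun (w : ℝ) : HasDerivAt gapFun
    ((w * Real.exp w - 2) * (2 * Real.exp (-w) +
      Real.exp (-w) ^ 2 * (w * Real.exp w - 2) / (1 + Real.exp (-w)) -
      2 * (Real.exp (-w) - Real.log (1 + Real.exp (-w))) * (1 + w) * Real.exp w)) w := by
  have hx : HasDerivAt (fun w : ℝ => Real.exp (-w)) (-Real.exp (-w)) w := by
    simpa using (hasDerivAt_neg w).exp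
  have hp := Real.exp_pos (-w)
  have hy : HasDerivAt (fun w : ℝ => w * Real.exp w - 2) ((1 + w) * Real.exp w) w := by
    convert! ((hasDerivAt_id w).mul (Real.hasDerivAt_exp w)).sub_const 2 using 1
    simp; ring
  have hl := (hx.const_add 1).log (by positivity)
  have hE : Real.exp w * Real.exp (-w) = 1 := by rw [← Real.exp_add]; simp
  convert! (((hasDerivAt_id w).pow 2).add (hx.const_mul 4)).sub ((hx.sub hl).mul (hy.pow 2)) using 1
  simp only [id, Pi.sub_apply, Pi.pow_apply]
  field_simp
  linear_combination (2 * w * (1 + Real.exp (-w))) * hE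

/-- Put x = exp(-w). The bound x - log(1 + x) ≤ x²/2 reduces the claim to x(1 + w) ≤ 1, that is, 1 +
w ≤ exp w. Hence the derivative of `gapFun` has the sign of w exp w - 2. -/
theorem gapFun_bracket_nonneg {w : ℝ} (hw : 0 ≤ w) : 0 ≤ 2 * Real.exp (-w) +
      Real.exp (-w) ^ 2 * (w * Real.exp w - 2) / (1 + Real.exp (-w)) -
      2 * (Real.exp (-w) - Real.log (1 + Real.exp (-w))) * (1 + w) * Real.exp w := by
  have hE : Real.exp w * Real.exp (-w) = 1 := by rw [← Real.exp_add]; simp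
  have h1 := Real.add_one_le_exp w
  set x := Real.exp (-w) with hx
  have hp : 0 < x := Real.exp_pos (-w)
  have hl : x - Real.log (1 + x) ≤ x ^ 2 / 2 :=
    (sub_log_one_add_le hp.le).trans (by gcongr; linarith)
  have h2 : 2 * (x - Real.log (1 + x)) * (1 + w) * Real.exp w ≤ x * (1 + w) := by
    calc _ ≤ 2 * (x ^ 2 / 2) * (1 + w) * Real.exp w := by gcongr
      _ = x * (1 + w) := by linear_combination (x * (1 + w)) * hE
  have h3 : x ^ 2 * (w * Real.exp w - 2) / (1 + x) = x * (w - 2 * x) / (1 + x) := by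
    congr 1; linear_combination x * w * hE
  have h4 : 2 * x + x * (w - 2 * x) / (1 + x) - x * (1 + w) =
      x * (1 - x * (1 + w)) / (1 + x) := by field_simp; ring
  have h5 : 0 ≤ x * (1 - x * (1 + w)) / (1 + x) := by
    have : 0 ≤ 1 - x * (1 + w) := by nlinarith
    positivity
  rw [h3]
  linarith

theorem gapFun_le {w₀ w : ℝ} (h₀ : 0 ≤ w₀) (hw₀ : w₀ * Real.exp w₀ = 2) (hw : 0 ≤ w) :
    gapFun w₀ ≤ gapFun w := by
  have hc : Continuous gapFun := continuous_iff_continuousAt.2 fun w =>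
    (hasDerivAt_gapFun w).continuousAt
  rcases le_total w₀ w with h | h
  · refine monotoneOn_of_deriv_nonneg (convex_Ici w₀) hc.continuousOn
      (fun x _ => (hasDerivAt_gapFun x).differentiableAt.differentiableWithinAt) (fun x hx => ?_)
      Set.self_mem_Ici h h
    rw [interior_Ici] at hx
    rw [(hasDerivAt_gapFun x).deriv]
    have := sub_le_mul_exp_sub h₀ (le_of_lt hx)
    exact mul_nonneg (by linarith [Set.mem_Ioi.1 hx]) (gapFun_bracket_nonneg (h₀.trans (le_of_lt hx)))
  · refine antitoneOn_of_deriv_nonpos (convex_Icc 0 w₀) hc.continuousOn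
      (fun x _ => (hasDerivAt_gapFun x).differentiableAt.differentiableWithinAt) (fun x hx => ?_)
      ⟨hw, h⟩ ⟨h₀, le_rfl⟩ h
    rw [interior_Icc] at hx
    rw [(hasDerivAt_gapFun x).deriv]
    have := sub_le_mul_exp_sub hx.1.le hx.2.le
    exact mul_nonpos_of_nonpos_of_nonneg (by linarith [hx.2]) (gapFun_bracket_nonneg hx.1.le)

/-- Multiplied by (d-2)² and expressed in w = W(d), this says that `gapFun` at W(2) is at most
`gapFun` at W(d). -/
theorem two_mul_meanExpNegWDeriv_le {d : ℝ} (hd : 0 ≤ d) :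
    2 * meanExpNegWDeriv d ≤ Real.log (1 + expNegW d) - expNegW d := by
  have hx := expNegW_pos d
  have hW := clampedW_nonneg d
  have hWd := clampedW_eq_mul_expNegW hd
  -- The factor (d-2)² vanishes at d = 2. There the claim follows from W(2) = 2x and x ≤ 1, which
  -- give 1 + W(2) ≤ x + 2.
  by_cases h2 : d = 2
  · subst h2
    have h1 : meanExpNegWDeriv 2 = expNegWDeriv 2 / 2 := by
      simp [meanExpNegWDeriv]
      ring
    have h3 := sub_log_one_add_le hx.le
    have h4 : expNegW 2 ≤ 1 := Real.exp_le_one_iff.2 (by linarith)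
    have h5 : expNegW 2 ^ 2 / (expNegW 2 + 2) ≤ expNegW 2 ^ 2 / (1 + clampedW 2) := by
      exact div_le_div_of_nonneg_left (by positivity) (by linarith) (by linarith)
    rw [h1, expNegWDeriv]
    linarith
  · have hg := gapFun_le (clampedW_nonneg 2) (clampedW_mul_exp zero_le_two) hW
    have hW2 := clampedW_eq_mul_expNegW (zero_le_two : (0:ℝ) ≤ 2)
    unfold gapFun at hg
    rw [clampedW_mul_exp zero_le_two, clampedW_mul_exp hd] at hg
    change _ + 4 * expNegW 2 - _ ≤ _ + 4 * expNegW d - (expNegW d - Real.log (1 + expNegW d)) * _ at hg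
    have hs : 0 < (d - 2) ^ 2 := by have := sub_ne_zero.2 h2; positivity
    refine le_of_mul_le_mul_right ?_ hs
    have e1 := mul_meanExpNegW hd
    have e2 := meanExpNegW_add_mul hd
    have e3 : 2 * meanExpNegWDeriv d * (d - 2) ^ 2 =
      2 * (d - 2) * expNegW d - 2 * ((d - 2) * meanExpNegW d) := by rw [← e2]; ring
    rw [e3, e1]
    nlinarith

/-! ### Closed forms and continuity of the two curves. -/

theorem lowerCurve_eq {d : ℝ} (hd : 0 ≤ d) : lowerCurve d = meanExpNegW d := by
  unfold lowerCurve
  split_ifs with h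
  · subst h
    have h1 := clampedW_eq_mul_expNegW (zero_le_two : (0:ℝ) ≤ 2)
    rw [← clampedW_of_nonneg hd, h1]
    simp [meanExpNegW]
  · have h1 := mul_meanExpNegW hd
    have : d - 2 ≠ 0 := sub_ne_zero.2 h
    rw [← clampedW_of_nonneg hd, ← clampedW_of_nonneg zero_le_two]
    field_simp
    linarith

theorem upperCurve_eq {d : ℝ} (hd : 0 ≤ d) :
    upperCurve d = expNegW d + d * expNegW d ^ 2 / 2 := by
  have h1 := clampedW_eq_mul_expNegW hd
  unfold upperCurve
  split_ifs with h
  · subst h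
    have : clampedW 0 = 0 := by simpa using h1
    simp [expNegW, this]
  · rw [← clampedW_of_nonneg hd, h1]
    field_simp
    ring

theorem continuousOn_lowerCurve : ContinuousOn lowerCurve (Set.Ici 0) :=
  continuous_meanExpNegW.continuousOn.congr fun _ hd => lowerCurve_eq hd

theorem continuousOn_upperCurve : ContinuousOn upperCurve (Set.Ici 0) := by
  have := continuous_expNegW
  exact ContinuousOn.congr (f := fun d => expNegW d + d * expNegW d ^ 2 / 2) (by fun_prop)
    fun _ hd => upperCurve_eq hd

/-! ### Independent sets and degree sums in induced subgraphs. -/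

open Classical in
/-- The neighbours of `v` that lie in `S`. -/
noncomputable def nbrsIn {V : Type*} (G : SimpleGraph V) (S : Finset V) (v : V) : Finset V :=
  S.filter (G.Adj v)

/-- The number of neighbours of `v` that lie in `S`. -/
noncomputable def degIn {V : Type*} (G : SimpleGraph V) (S : Finset V) (v : V) : ℕ :=
  (nbrsIn G S v).card

/-- The sum of the degrees of the graph induced on `S`. -/
noncomputable def degSumIn {V : Type*} (G : SimpleGraph V) (S : Finset V) : ℕ :=
  ∑ v ∈ S, degIn G S v

open Classical in
/-- The number of independent sets contained in `S`. -/
noncomputable def indepIn {V : Type*} (G : SimpleGraph V) (S : Finset V) : ℕ :=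
  (S.powerset.filter fun I : Finset V => G.IsIndepSet (I : Set V)).card

theorem mem_nbrsIn {V : Type*} {G : SimpleGraph V} {S : Finset V} {v u : V} :
    u ∈ nbrsIn G S v ↔ u ∈ S ∧ G.Adj v u := by
  simp [nbrsIn]

theorem indepIn_pos {V : Type*} (G : SimpleGraph V) (S : Finset V) : 0 < indepIn G S := by
  classical
  exact Finset.card_pos.2 ⟨∅, by simp [SimpleGraph.IsIndepSet]⟩

open Classical in
-- Split by whether v is used; I ↦ I ∪ {v} injects the second family.
theorem indepIn_erase_add_le {V : Type*} (G : SimpleGraph V) {S : Finset V} {v : V} (hv : v ∈ S) :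
    indepIn G (S.erase v) + indepIn G (S \ insert v (nbrsIn G S v)) ≤ indepIn G S := by
  have hinj : Set.InjOn (insert v) (((S \ insert v (nbrsIn G S v)).powerset.filter
      fun I : Finset V => G.IsIndepSet (I : Set V) : Finset (Finset V)) : Set (Finset V)) := by
    intro I hI J hJ h
    simp only [Finset.coe_filter, Finset.mem_powerset, Set.mem_ofPred_eq] at hI hJ
    have hvI : v ∉ I := fun h => by simpa using hI.1 h
    have hvJ : v ∉ J := fun h => by simpa using hJ.1 h
    rw [← Finset.erase_insert hvI, ← Finset.erase_insert hvJ, h]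
  unfold indepIn
  rw [← Finset.card_image_of_injOn hinj, ← Finset.card_union_of_disjoint]
  · apply Finset.card_le_card
    intro I hI
    simp only [Finset.mem_union, Finset.mem_filter, Finset.mem_powerset, Finset.mem_image] at hI ⊢
    rcases hI with ⟨hI, hi⟩ | ⟨J, ⟨hJ, hj⟩, rfl⟩
    · exact ⟨hI.trans (Finset.erase_subset _ _), hi⟩
    · refine ⟨Finset.insert_subset hv (hJ.trans Finset.sdiff_subset), ?_⟩
      rw [Finset.coe_insert, SimpleGraph.IsIndepSet, Set.pairwise_insert]
      refine ⟨hj, fun b hb _ => ?_⟩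
      have hb' := hJ hb
      simp only [Finset.mem_sdiff, Finset.mem_insert, mem_nbrsIn, not_or, not_and] at hb'
      exact ⟨hb'.2.2 hb'.1, fun h => hb'.2.2 hb'.1 h.symm⟩
  · rw [Finset.disjoint_left]
    intro I hI hI'
    simp only [Finset.mem_filter, Finset.mem_powerset, Finset.mem_image] at hI hI'
    obtain ⟨J, -, rfl⟩ := hI'
    exact Finset.notMem_erase v S (hI.1 (Finset.mem_insert_self v J))

open Classical in
theorem degIn_eq_sum {V : Type*} (G : SimpleGraph V) (S : Finset V) (v : V) :
    degIn G S v = ∑ u ∈ S, if G.Adj v u then 1 else 0 := by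
  rw [degIn, nbrsIn, Finset.card_filter]

open Classical in
-- As T is independent, each edge meeting T has exactly one end there, so ∑ deg over T counts the
-- lost edges without repetition.
theorem degSumIn_add_le {V : Type*} (G : SimpleGraph V) {R S T : Finset V} (hT : T ⊆ S)
    (hR : R ⊆ S \ T) (hind : G.IsIndepSet (T : Set V)) :
    degSumIn G R + 2 * ∑ u ∈ T, degIn G S u ≤ degSumIn G S := by
  simp only [degSumIn, degIn_eq_sum]
  set a : V → V → ℕ := fun x y => if G.Adj x y then 1 else 0 with ha
  change ∑ x ∈ R, ∑ y ∈ R, a x y + 2 * ∑ x ∈ T, ∑ y ∈ S, a x y ≤ ∑ x ∈ S, ∑ y ∈ S, a x y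
  have h0 : ∑ x ∈ T, ∑ y ∈ T, a x y = 0 := by
    refine Finset.sum_eq_zero fun x hx => Finset.sum_eq_zero fun y hy => ?_
    simp only [ha, ite_eq_right_iff, one_ne_zero, imp_false]
    intro hxy
    exact hind hx hy hxy.ne hxy
  have h1 : ∑ x ∈ S \ T, ∑ y ∈ T, a x y = ∑ x ∈ T, ∑ y ∈ S \ T, a x y := by
    rw [Finset.sum_comm]
    simp only [ha, G.adj_comm]
  have h2 : ∑ x ∈ R, ∑ y ∈ R, a x y ≤ ∑ x ∈ S \ T, ∑ y ∈ S \ T, a x y :=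
    (Finset.sum_le_sum fun x _ => Finset.sum_le_sum_of_subset hR).trans
      (Finset.sum_le_sum_of_subset hR)
  have h3 : ∀ x, ∑ y ∈ S, a x y = ∑ y ∈ S \ T, a x y + ∑ y ∈ T, a x y := fun x =>
    (Finset.sum_sdiff hT).symm
  rw [← Finset.sum_sdiff hT (f := fun x => ∑ y ∈ S, a x y)]
  simp only [h3, Finset.sum_add_distrib]
  omega

theorem sum_sum_nbrsIn {V : Type*} (G : SimpleGraph V) (S : Finset V) :
    ∑ v ∈ S, ∑ u ∈ nbrsIn G S v, degIn G S u = ∑ u ∈ S, degIn G S u ^ 2 := by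
  classical
  have h : ∀ u, degIn G S u ^ 2 = ∑ v ∈ S, if G.Adj v u then degIn G S u else 0 := by
    intro u
    simp only [G.adj_comm _ u]
    rw [← Finset.sum_filter, Finset.sum_const, smul_eq_mul, sq, degIn, nbrsIn]
  simp only [h, nbrsIn, Finset.sum_filter]
  exact Finset.sum_comm

/-! ### The lower bound by induction on the vertex set. -/

/-- The differential equation makes the second exponent equal to the first minus d x. As exp(-d x) =
x, the sum is exp(-f - pd)(1 + x), and f + pd = x + 2p ≤ log(1 + x). -/
theorem one_le_exp_add_exp {d : ℝ} (hd : 0 ≤ d) :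
    1 ≤ Real.exp (-meanExpNegW d - meanExpNegWDeriv d * d) +
      Real.exp (-(1 + d) * meanExpNegW d + meanExpNegWDeriv d * (d - d ^ 2)) := by
  have h1 := meanExpNegW_add_mul hd
  have h2 := two_mul_meanExpNegWDeriv_le hd
  have hx := expNegW_pos d
  set f := meanExpNegW d
  set p := meanExpNegWDeriv d
  have e1 : -(1 + d) * f + p * (d - d ^ 2) = (-f - p * d) + -(d * expNegW d) := by
    rw [← h1]; ring
  have h3 : Real.exp (f + p * d) ≤ 1 + expNegW d := by
    rw [← Real.le_log_iff_exp_le (by positivity)]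
    linarith
  have h4 : Real.exp (-f - p * d) * Real.exp (f + p * d) = 1 := by
    rw [← Real.exp_add]; simp
  rw [e1, Real.exp_add, exp_neg_mul_expNegW hd]
  nlinarith [Real.exp_pos (-f - p * d)]

theorem exp_mul_le_exp (c a : ℝ) : Real.exp c * (1 + (a - c)) ≤ Real.exp a := by
  have h := Real.add_one_le_exp (a - c)
  have : Real.exp a = Real.exp c * Real.exp (a - c) := by rw [← Real.exp_add]; simp
  rw [this]
  exact mul_le_mul_of_nonneg_left (by linarith) (Real.exp_pos c).le

/-- If every vertex failed, so would the sum over S. Replacing each exponential by its tangent at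
the exponent of a d-regular graph makes that sum computable. -/
theorem exists_one_le_exp_add_exp {V : Type*} (G : SimpleGraph V) {S : Finset V}
    (hS : S.Nonempty) {d : ℝ} (hd : (degSumIn G S : ℝ) = S.card * d) :
    ∃ v ∈ S, 1 ≤ Real.exp (-meanExpNegW d + meanExpNegWDeriv d * (d - 2 * degIn G S v)) +
      Real.exp (-(1 + degIn G S v) * meanExpNegW d + meanExpNegWDeriv d *
        (d + d * degIn G S v - 2 * ∑ u ∈ nbrsIn G S v, (degIn G S u : ℝ))) := by
  have hn : (0 : ℝ) < S.card := by exact_mod_cast hS.card_pos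
  have hd0 : 0 ≤ d := by
    have : (0 : ℝ) ≤ S.card * d := by rw [← hd]; positivity
    exact nonneg_of_mul_nonneg_right this hn
  have hone := one_le_exp_add_exp hd0
  have hp := meanExpNegWDeriv_nonpos d
  set f := meanExpNegW d
  set p := meanExpNegWDeriv d
  set ca := -f - p * d
  set cb := -(1 + d) * f + p * (d - d ^ 2)
  by_contra! hlt
  have h1 : ∑ v ∈ S, (Real.exp ca * (1 + ((-f + p * (d - 2 * degIn G S v)) - ca)) +
      Real.exp cb * (1 + ((-(1 + degIn G S v) * f + p *
        (d + d * degIn G S v - 2 * ∑ u ∈ nbrsIn G S v, (degIn G S u : ℝ))) - cb))) <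
      ∑ v ∈ S, (1 : ℝ) :=
    Finset.sum_lt_sum_of_nonempty hS fun v hv =>
      (add_le_add (exp_mul_le_exp _ _) (exp_mul_le_exp _ _)).trans_lt (hlt v hv)
  have hs : ∑ v ∈ S, (degIn G S v : ℝ) = S.card * d := by rw [← hd, degSumIn]; push_cast; rfl
  have hss : ∑ v ∈ S, ∑ u ∈ nbrsIn G S v, (degIn G S u : ℝ) = ∑ v ∈ S, (degIn G S v : ℝ) ^ 2 := by
    exact_mod_cast sum_sum_nbrsIn G S
  -- Cauchy–Schwarz, as nonnegativity of the variance of the degrees. The sign p ≤ 0 makes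
  -- irregularity only help.
  have hcs : S.card * d ^ 2 ≤ ∑ v ∈ S, (degIn G S v : ℝ) ^ 2 := by
    have h : 0 ≤ ∑ v ∈ S, ((degIn G S v : ℝ) - d) ^ 2 := Finset.sum_nonneg fun _ _ => sq_nonneg _
    have h' : ∑ v ∈ S, ((degIn G S v : ℝ) - d) ^ 2 = ∑ v ∈ S, (degIn G S v : ℝ) ^ 2 -
        2 * d * ∑ v ∈ S, (degIn G S v : ℝ) + S.card * d ^ 2 := by
      rw [Finset.mul_sum, ← Finset.sum_sub_distrib, ← nsmul_eq_mul, ← Finset.sum_const,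
        ← Finset.sum_add_distrib]
      exact Finset.sum_congr rfl fun _ _ => by ring
    rw [h', hs] at h
    linarith
  have h2 : ∑ v ∈ S, (Real.exp ca * (1 + ((-f + p * (d - 2 * degIn G S v)) - ca)) +
      Real.exp cb * (1 + ((-(1 + degIn G S v) * f + p *
        (d + d * degIn G S v - 2 * ∑ u ∈ nbrsIn G S v, (degIn G S u : ℝ))) - cb))) =
      Real.exp ca * S.card + Real.exp cb * (S.card + 2 * p * (S.card * d ^ 2 -
        ∑ v ∈ S, (degIn G S v : ℝ) ^ 2)) := by
    rw [← hss]
    have e : ∀ v ∈ S, Real.exp ca * (1 + ((-f + p * (d - 2 * degIn G S v)) - ca)) +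
      Real.exp cb * (1 + ((-(1 + degIn G S v) * f + p *
        (d + d * degIn G S v - 2 * ∑ u ∈ nbrsIn G S v, (degIn G S u : ℝ))) - cb)) =
        (Real.exp ca * (1 + 2 * p * d) + Real.exp cb * (1 + d * f + p * d ^ 2)) +
        (Real.exp cb * (p * d - f) - Real.exp ca * (2 * p)) * degIn G S v -
        Real.exp cb * (2 * p) * ∑ u ∈ nbrsIn G S v, (degIn G S u : ℝ) := by
      intro v _
      simp only [ca, cb]
      ring
    rw [Finset.sum_congr rfl e, Finset.sum_sub_distrib, Finset.sum_add_distrib, ← Finset.mul_sum,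
      ← Finset.mul_sum, hs, Finset.sum_const, nsmul_eq_mul]
    ring
  have h3 : (S.card : ℝ) ≤ S.card + 2 * p * (S.card * d ^ 2 - ∑ v ∈ S, (degIn G S v : ℝ) ^ 2) := by
    nlinarith
  have h4 := mul_le_mul_of_nonneg_left h3 (Real.exp_pos cb).le
  rw [h2, Finset.sum_const, nsmul_eq_mul, mul_one] at h1
  nlinarith

/-- The tangent at a fixed d makes the induction hypothesis linear in the order and degree sum of R.
For empty R both are 0. -/
theorem dual_le_log_indepIn {V : Type*} {G : SimpleGraph V} {R : Finset V}
    (h : R.card * meanExpNegW (degSumIn G R / R.card) ≤ Real.log (indepIn G R))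
    {d : ℝ} (hd : 0 ≤ d) :
    R.card * meanExpNegW d + meanExpNegWDeriv d * (degSumIn G R - R.card * d) ≤
      Real.log (indepIn G R) := by
  refine le_trans ?_ h
  rcases R.eq_empty_or_nonempty with rfl | hR
  · simp [degSumIn]
  · have hn : (0 : ℝ) < R.card := by exact_mod_cast hR.card_pos
    have := mul_le_mul_of_nonneg_left
      (meanExpNegW_tangent hd (t := (degSumIn G R : ℝ) / R.card) (by positivity)) hn.le
    refine le_trans (le_of_eq ?_) this
    field_simp

theorem card_mul_le_log_indepIn {V : Type*} {G : SimpleGraph V} (hG : G.CliqueFree 3)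
    (S : Finset V) :
    S.card * meanExpNegW (degSumIn G S / S.card) ≤ Real.log (indepIn G S) := by
  classical
  induction S using Finset.strongInduction with
  | H S ih =>
  rcases S.eq_empty_or_nonempty with rfl | hS
  · simpa using Real.log_natCast_nonneg _
  have hn : (0 : ℝ) < S.card := by exact_mod_cast hS.card_pos
  set d : ℝ := degSumIn G S / S.card with hd
  have hd0 : 0 ≤ d := by positivity
  have hdS : (degSumIn G S : ℝ) = S.card * d := by rw [hd]; field_simp
  have hp := meanExpNegWDeriv_nonpos d
  obtain ⟨v, hv, hone⟩ := exists_one_le_exp_add_exp G hS hdS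
  have hNS : nbrsIn G S v ⊆ S := fun u hu => (mem_nbrsIn.1 hu).1
  have hvN : v ∉ nbrsIn G S v := fun h => G.irrefl (mem_nbrsIn.1 h).2
  have hins : insert v (nbrsIn G S v) ⊆ S := Finset.insert_subset hv hNS
  have i1 := dual_le_log_indepIn (ih _ (Finset.erase_ssubset hv)) hd0
  have i2 := dual_le_log_indepIn (ih (S \ insert v (nbrsIn G S v))
    (Finset.sdiff_ssubset hins ⟨v, Finset.mem_insert_self _ _⟩)) hd0
  have c1 : ((S.erase v).card : ℝ) = S.card - 1 := by
    rw [← Finset.card_erase_add_one hv]; push_cast; ring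
  have c2 : ((S \ insert v (nbrsIn G S v)).card : ℝ) = S.card - (1 + degIn G S v) := by
    rw [Finset.cast_card_sdiff hins, Finset.card_insert_of_notMem hvN, degIn]
    push_cast; ring
  have e1 : (degSumIn G (S.erase v) : ℝ) + 2 * degIn G S v ≤ S.card * d := by
    rw [← hdS]
    have := degSumIn_add_le G (R := S.erase v) (T := {v}) (Finset.singleton_subset_iff.2 hv)
      (Finset.erase_eq S v).le (by simp [SimpleGraph.IsIndepSet])
    rw [Finset.sum_singleton] at this
    exact_mod_cast this
  have e2 : (degSumIn G (S \ insert v (nbrsIn G S v)) : ℝ) +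
      2 * ∑ u ∈ nbrsIn G S v, (degIn G S u : ℝ) ≤ S.card * d := by
    rw [← hdS]
    have := degSumIn_add_le G (R := S \ insert v (nbrsIn G S v)) hNS
      (Finset.sdiff_subset_sdiff le_rfl (Finset.subset_insert _ _)) (by
        -- Two adjacent neighbours of v would form a triangle with it.
        intro x hx y hy hxy hadj
        exact hG {v, x, y} (SimpleGraph.is3Clique_triple_iff.2
          ⟨(mem_nbrsIn.1 hx).2, (mem_nbrsIn.1 hy).2, hadj⟩))
    exact_mod_cast this
  rw [c1] at i1
  rw [c2] at i2
  rw [Real.le_log_iff_exp_le (by exact_mod_cast indepIn_pos G S)]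
  rw [Real.le_log_iff_exp_le (by exact_mod_cast indepIn_pos G _)] at i1 i2
  have hi : (indepIn G (S.erase v) : ℝ) + indepIn G (S \ insert v (nbrsIn G S v)) ≤
    indepIn G S := by exact_mod_cast indepIn_erase_add_le G hv
  refine le_trans ?_ hi
  refine le_trans ?_ (add_le_add
    (((Real.exp_le_exp (x := (S.card : ℝ) * meanExpNegW d +
      (-meanExpNegW d + meanExpNegWDeriv d * (d - 2 * degIn G S v)))).2 ?_).trans i1)
    (((Real.exp_le_exp (x := (S.card : ℝ) * meanExpNegW d + (-(1 + degIn G S v) * meanExpNegW d +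
      meanExpNegWDeriv d *
        (d + d * degIn G S v - 2 * ∑ u ∈ nbrsIn G S v, (degIn G S u : ℝ))))).2 ?_).trans i2))
  · rw [Real.exp_add, Real.exp_add _ (-(1 + _) * _ + _), ← mul_add]
    exact le_mul_of_one_le_right (Real.exp_pos _).le hone
  · nlinarith
  · nlinarith

theorem avgDegree_eq {V : Type} [Fintype V] (G : SimpleGraph V) :
    avgDegree G = degSumIn G Finset.univ / (Fintype.card V : ℝ) := by
  rw [avgDegree, degSumIn]
  push_cast
  congr 1
  refine Finset.sum_congr rfl fun v _ => ?_
  rw [degIn, nbrsIn, ← SimpleGraph.card_neighborFinset_eq_degree]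
  congr 2
  ext u
  simp

theorem lowerCurve_le_of_mem {d x : ℝ} (hd : 0 ≤ d) (hx : x ∈ logIndepDensities d) :
    lowerCurve d ≤ x := by
  classical
  obtain ⟨V, _, _, G, hG, hdeg, rfl⟩ := hx
  have h := card_mul_le_log_indepIn hG Finset.univ
  have e1 : indepIn G Finset.univ = numIndepSets G := by
    simp only [indepIn, numIndepSets, Finset.powerset_univ]
  have h0 : 0 ≤ avgDegree G := by unfold avgDegree; positivity
  have hn : (0 : ℝ) < Fintype.card V := by exact_mod_cast Fintype.card_pos
  rw [e1, Finset.card_univ, ← avgDegree_eq] at h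
  rw [lowerCurve_eq hd, le_div_iff₀ hn, mul_comm]
  exact (mul_le_mul_of_nonneg_left (meanExpNegW_anti h0 hdeg) hn.le).trans h

/-! ### The upper bound: a derandomized triangle-free process. -/

/-- The vertices `u` and `v` may be joined without creating a triangle or a vertex of degree
greater than `D`. -/
def CanJoin {V : Type*} [Fintype V] (G : SimpleGraph V) (D : ℕ) (u v : V) : Prop :=
  u ≠ v ∧ degIn G Finset.univ u < D ∧ degIn G Finset.univ v < D ∧ ∀ w, ¬(G.Adj w u ∧ G.Adj w v)

theorem cliqueFree_sup_edge {V : Type*} {G : SimpleGraph V} (hG : G.CliqueFree 3) {u v : V}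
    (h : ∀ w, ¬(G.Adj w u ∧ G.Adj w v)) : (G ⊔ SimpleGraph.edge u v).CliqueFree 3 := by
  classical
  have key : ∀ a b c, G.Adj a b → G.Adj a c → ¬G.Adj b c := fun a b c h1 h2 h3 =>
    hG {a, b, c} (SimpleGraph.is3Clique_triple_iff.2 ⟨h1, h2, h3⟩)
  have hs : ∀ a b, G.Adj a b → G.Adj b a := fun a b h => h.symm
  intro s hcl
  obtain ⟨a, b, c, hab, hac, hbc, -⟩ := SimpleGraph.is3Clique_iff.1 hcl
  simp only [SimpleGraph.sup_adj, SimpleGraph.edge_adj] at hab hac hbc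
  grind

open Classical in
theorem degIn_sup_edge_le {V : Type*} (G : SimpleGraph V) (S : Finset V) (u v x : V) :
    degIn (G ⊔ SimpleGraph.edge u v) S x ≤
      degIn G S x + ((if x = u then 1 else 0) + if x = v then 1 else 0) := by
  have hsub : nbrsIn (G ⊔ SimpleGraph.edge u v) S x ⊆
      nbrsIn G S x ∪ ((if x = u then {v} else ∅) ∪ if x = v then {u} else ∅) := by
    intro y hy
    simp only [mem_nbrsIn, SimpleGraph.sup_adj, SimpleGraph.edge_adj] at hy
    simp only [Finset.mem_union, mem_nbrsIn]
    grind
  refine (Finset.card_le_card hsub).trans ((Finset.card_union_le _ _).trans ?_)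
  refine Nat.add_le_add_left ((Finset.card_union_le _ _).trans (Nat.add_le_add ?_ ?_)) _ <;>
    split_ifs <;> simp

theorem degSumIn_sup_edge_le {V : Type*} (G : SimpleGraph V) (S : Finset V) (u v : V) :
    degSumIn (G ⊔ SimpleGraph.edge u v) S ≤ degSumIn G S + 2 := by
  classical
  refine (Finset.sum_le_sum fun x _ => degIn_sup_edge_le G S u v x).trans ?_
  rw [Finset.sum_add_distrib, Finset.sum_add_distrib, Finset.sum_ite_eq', Finset.sum_ite_eq',
    degSumIn]
  split_ifs <;> omega

open Classical in
-- A bad pair is diagonal, contains a vertex of degree at least D (few, by Markov), or has a common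
-- neighbour (at most D² ordered pairs for each one).
theorem card_not_canJoin_le {V : Type*} [Fintype V] (G : SimpleGraph V) {D : ℕ} (hD : 0 < D)
    (hdeg : ∀ v, degIn G Finset.univ v ≤ D) :
    ((Finset.univ.filter fun q : V × V => ¬CanJoin G D q.1 q.2).card : ℝ) ≤
      Fintype.card V + 2 * Fintype.card V * degSumIn G Finset.univ / D + Fintype.card V * D ^ 2 := by
  set H := Finset.univ.filter fun v => D ≤ degIn G Finset.univ v with hH
  have hHc : (H.card : ℝ) ≤ degSumIn G Finset.univ / D := by
    rw [le_div_iff₀ (by exact_mod_cast hD)]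
    have : H.card * D ≤ degSumIn G Finset.univ := by
      rw [← smul_eq_mul]
      refine (Finset.card_nsmul_le_sum H (degIn G Finset.univ) D fun v hv => ?_).trans
        (Finset.sum_le_sum_of_subset (Finset.subset_univ H))
      exact (Finset.mem_filter.1 hv).2
    exact_mod_cast this
  have hsub : (Finset.univ.filter fun q : V × V => ¬CanJoin G D q.1 q.2) ⊆
      Finset.univ.diag ∪ (H ×ˢ Finset.univ ∪ (Finset.univ ×ˢ H ∪ Finset.univ.biUnion fun w =>
        nbrsIn G Finset.univ w ×ˢ nbrsIn G Finset.univ w)) := by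
    rintro ⟨u, v⟩ hq
    simp only [CanJoin, Finset.mem_filter, Finset.mem_univ, true_and, not_and_or, not_not,
      not_lt, not_forall] at hq
    simp only [Finset.mem_union, Finset.mem_diag, Finset.mem_product, Finset.mem_univ, true_and,
      and_true, Finset.mem_biUnion, mem_nbrsIn, hH, Finset.mem_filter]
    simpa only [not_or, not_not] using hq
  have hN : (Finset.univ.biUnion fun w =>
      nbrsIn G Finset.univ w ×ˢ nbrsIn G Finset.univ w).card ≤ Fintype.card V * D ^ 2 := by
    refine Finset.card_biUnion_le_card_mul _ _ _ fun w _ => ?_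
    rw [Finset.card_product, sq]
    exact Nat.mul_le_mul (hdeg w) (hdeg w)
  have h1 : (Finset.univ.filter fun q : V × V => ¬CanJoin G D q.1 q.2).card ≤
      Fintype.card V + (H.card * Fintype.card V + (Fintype.card V * H.card +
        Fintype.card V * D ^ 2)) := by
    refine (Finset.card_le_card hsub).trans ((Finset.card_union_le _ _).trans ?_)
    rw [Finset.diag_card, Finset.card_univ]
    refine Nat.add_le_add_left ((Finset.card_union_le _ _).trans ?_) _
    rw [Finset.card_product, Finset.card_univ]
    refine Nat.add_le_add_left ((Finset.card_union_le _ _).trans ?_) _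
    rw [Finset.card_product, Finset.card_univ]
    exact Nat.add_le_add_left hN _
  have h2 : ((Finset.univ.filter fun q : V × V => ¬CanJoin G D q.1 q.2).card : ℝ) ≤
      Fintype.card V + (H.card * Fintype.card V + (Fintype.card V * H.card +
        Fintype.card V * D ^ 2)) := by exact_mod_cast h1
  have h3 := mul_le_mul_of_nonneg_left hHc (Nat.cast_nonneg (α := ℝ) (Fintype.card V))
  have h4 : 2 * Fintype.card V * degSumIn G Finset.univ / (D : ℝ) =
    2 * (Fintype.card V * (degSumIn G Finset.univ / (D : ℝ))) := by ring
  rw [h4]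
  linarith

open Classical in
/-- The sum of `w I ^ r` over the independent sets `I` of `G`. -/
noncomputable def indepWeight {V : Type*} [Fintype V] (G : SimpleGraph V) (w : Finset V → ℝ)
    (r : ℕ) : ℝ :=
  ∑ I ∈ Finset.univ.filter (fun I : Finset V => G.IsIndepSet (I : Set V)), w I ^ r

/-- Here n² · w I bounds the number of ordered pairs whose choice leaves I independent. Averaged
over all pairs, a step trades one factor w I for survival of I, so some pair does at least as well.
The exponent r is the number of steps left. -/
theorem exists_indepWeight_le {V : Type*} [Fintype V] [Nonempty V] {G : SimpleGraph V}
    (hG : G.CliqueFree 3) {D : ℕ} (hD : 0 < D) (hdeg : ∀ v, degIn G Finset.univ v ≤ D)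
    {w : Finset V → ℝ} (hw0 : ∀ I, 0 ≤ w I)
    (hw : ∀ I, (Fintype.card V : ℝ) ^ 2 - (I.card : ℝ) ^ 2 + (Fintype.card V +
      2 * Fintype.card V * degSumIn G Finset.univ / D + Fintype.card V * D ^ 2) ≤
      (Fintype.card V : ℝ) ^ 2 * w I) (r : ℕ) :
    ∃ G' : SimpleGraph V, G'.CliqueFree 3 ∧ (∀ v, degIn G' Finset.univ v ≤ D) ∧
      degSumIn G' Finset.univ ≤ degSumIn G Finset.univ + 2 ∧
      indepWeight G' w r ≤ indepWeight G w (r + 1) := by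
  classical
  set n : ℝ := (Fintype.card V : ℝ) with hn
  have hnpos : 0 < n := by rw [hn]; exact_mod_cast Fintype.card_pos
  set next : V × V → SimpleGraph V := fun q =>
    if CanJoin G D q.1 q.2 then G ⊔ SimpleGraph.edge q.1 q.2 else G with hnext
  have hle : ∀ q, G ≤ next q := fun q => by
    simp only [hnext]
    split_ifs
    · exact le_sup_left
    · exact le_rfl
  have hcount : ∀ I : Finset V, G.IsIndepSet (I : Set V) →
      ((Finset.univ.filter fun q => (next q).IsIndepSet (I : Set V)).card : ℝ) ≤ n ^ 2 * w I := by
    intro I hI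
    refine le_trans ?_ (hw I)
    have hsub : (Finset.univ.filter fun q => (next q).IsIndepSet (I : Set V)) ⊆
        (I ×ˢ I)ᶜ ∪ Finset.univ.filter fun q : V × V => ¬CanJoin G D q.1 q.2 := by
      intro q hq
      simp only [Finset.mem_union, Finset.mem_compl, Finset.mem_product, Finset.mem_filter,
        Finset.mem_univ, true_and] at hq ⊢
      by_contra! hcon
      simp only [hnext, if_pos hcon.2] at hq
      refine hq hcon.1.1 hcon.1.2 hcon.2.1 ?_
      simp [SimpleGraph.sup_adj, SimpleGraph.edge_adj, hcon.2.1]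
    have h1 : ((Finset.univ.filter fun q => (next q).IsIndepSet (I : Set V)).card : ℝ) ≤
        ((I ×ˢ I)ᶜ.card : ℝ) +
          (Finset.univ.filter fun q : V × V => ¬CanJoin G D q.1 q.2).card := by
      exact_mod_cast (Finset.card_le_card hsub).trans (Finset.card_union_le _ _)
    have h2 : ((I ×ˢ I)ᶜ.card : ℝ) = n ^ 2 - (I.card : ℝ) ^ 2 := by
      rw [Finset.card_compl, Nat.cast_sub (Finset.card_le_univ _), Fintype.card_prod,
        Finset.card_product]
      push_cast
      ring
    linarith [card_not_canJoin_le G hD hdeg]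
  have hsum : ∑ q : V × V, n ^ 2 * indepWeight (next q) w r ≤
      ∑ q : V × V, n ^ 2 * indepWeight G w (r + 1) := by
    rw [← Finset.mul_sum, Finset.sum_const, nsmul_eq_mul, Finset.card_univ, Fintype.card_prod,
      Nat.cast_mul, ← hn, ← sq]
    refine mul_le_mul_of_nonneg_left ?_ (by positivity)
    simp only [indepWeight, Finset.sum_filter]
    rw [Finset.sum_comm, Finset.mul_sum]
    refine Finset.sum_le_sum fun I _ => ?_
    split_ifs with hI
    · rw [← Finset.sum_filter, Finset.sum_const, nsmul_eq_mul, pow_succ' (w I) r, ← mul_assoc]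
      exact mul_le_mul_of_nonneg_right (hcount I hI) (pow_nonneg (hw0 I) r)
    · rw [mul_zero]
      refine (Finset.sum_eq_zero fun q _ => if_neg fun h => hI ?_).le
      exact fun a ha b hb hab hadj => h ha hb hab (hle q hadj)
  obtain ⟨q, -, hq⟩ := Finset.exists_le_of_sum_le Finset.univ_nonempty hsum
  -- An inadmissible choice leaves the graph unchanged, so all invariants persist in either case.
  refine ⟨next q, ?_, ?_, ?_, le_of_mul_le_mul_left hq (by positivity)⟩
  · simp only [hnext]
    split_ifs with h
    · exact cliqueFree_sup_edge hG h.2.2.2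
    · exact hG
  · intro x
    simp only [hnext]
    split_ifs with h
    · refine (degIn_sup_edge_le G Finset.univ q.1 q.2 x).trans ?_
      have := hdeg x
      obtain ⟨h1, h2, h3, -⟩ := h
      by_cases hx : x = q.1
      · subst hx
        rw [if_pos rfl, if_neg h1]
        omega
      · rw [if_neg hx]
        split_ifs with hx'
        · subst hx'
          omega
        · omega
    · exact hdeg x
  · simp only [hnext]
    split_ifs with h
    · exact degSumIn_sup_edge_le _ _ _ _
    · omega

/-- Run m steps from the empty graph. At exponent 0 the weight is the number of independent sets. -/
theorem exists_graph_numIndepSets_le {n m D : ℕ} (hn : 0 < n) (hD : 0 < D) {d ε : ℝ}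
    (hm : 2 * (m : ℝ) ≤ d * n) (hε : 1 / n + 2 * d / D + (D : ℝ) ^ 2 / n = ε) (hd : 0 ≤ d) :
    ∃ G : SimpleGraph (Fin n), G.CliqueFree 3 ∧ degSumIn G Finset.univ ≤ 2 * m ∧
      (numIndepSets G : ℝ) ≤
        ∑ I : Finset (Fin n), (1 + (ε - (I.card : ℝ) ^ 2 / (n : ℝ) ^ 2)) ^ m := by
  classical
  have : Nonempty (Fin n) := ⟨⟨0, hn⟩⟩
  have hnpos : (0 : ℝ) < n := by exact_mod_cast hn
  have hDpos : (0 : ℝ) < D := by exact_mod_cast hD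
  have hε0 : 0 ≤ ε := by rw [← hε]; positivity
  set w : Finset (Fin n) → ℝ := fun I => 1 + (ε - (I.card : ℝ) ^ 2 / (n : ℝ) ^ 2) with hw
  have hw0 : ∀ I, 0 ≤ w I := by
    intro I
    have h1 : (I.card : ℝ) ≤ n := by exact_mod_cast card_finset_fin_le I
    have h2 : (I.card : ℝ) ^ 2 / (n : ℝ) ^ 2 ≤ 1 := by
      rw [div_le_one (by positivity)]
      gcongr
    simp only [hw]
    linarith
  have key : ∀ j ≤ m, ∃ G : SimpleGraph (Fin n), G.CliqueFree 3 ∧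
      (∀ v, degIn G Finset.univ v ≤ D) ∧ degSumIn G Finset.univ ≤ 2 * j ∧
      indepWeight G w (m - j) ≤ ∑ I, w I ^ m := by
    intro j
    induction j with
    | zero =>
      have h0 : ∀ v, degIn (⊥ : SimpleGraph (Fin n)) Finset.univ v = 0 := fun v => by
        simp [degIn, nbrsIn]
      refine fun _ => ⟨⊥, SimpleGraph.cliqueFree_bot (by norm_num), fun v => by simp [h0],
        by simp [degSumIn, h0], ?_⟩
      exact Finset.sum_le_sum_of_subset_of_nonneg (Finset.subset_univ _)
        fun I _ _ => pow_nonneg (hw0 I) _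
    | succ j ih =>
      intro hj
      obtain ⟨G, hG, hdeg, hs, hwt⟩ := ih (by omega)
      have hsd : (degSumIn G Finset.univ : ℝ) ≤ d * n := by
        have : (degSumIn G Finset.univ : ℝ) ≤ 2 * m := by exact_mod_cast (by omega)
        linarith
      obtain ⟨G', hG', hdeg', hs', hwt'⟩ := exists_indepWeight_le hG hD hdeg hw0 (fun I => by
        rw [Fintype.card_fin]
        have h1 : 2 * n * degSumIn G Finset.univ / (D : ℝ) ≤ 2 * n * (d * n) / D := by gcongr
        have h2 : (n : ℝ) ^ 2 * w I =
            (n : ℝ) ^ 2 - (I.card : ℝ) ^ 2 + (n + 2 * n * (d * n) / D + n * D ^ 2) := by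
          simp only [hw, ← hε]
          field_simp
          ring
        linarith) (m - (j + 1))
      refine ⟨G', hG', hdeg', by omega, hwt'.trans ?_⟩
      rwa [show m - (j + 1) + 1 = m - j by omega]
  obtain ⟨G, hG, -, hs, hwt⟩ := key m le_rfl
  refine ⟨G, hG, hs, le_trans (le_of_eq ?_) hwt⟩
  simp only [indepWeight, Nat.sub_self, pow_zero, Finset.sum_const, nsmul_eq_mul, mul_one,
    numIndepSets]

/-! ### Evaluation of the bound and choice of parameters. -/

theorem sum_one_add_pow_le {n m : ℕ} (hn : 0 < n) {d ε x : ℝ} (hm : 2 * (m : ℝ) ≤ d * n)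
    (hm' : d * n ≤ 2 * (m + 1)) (hε : 0 ≤ ε) (hd : 0 ≤ d) (hx : Real.exp (-(d * x)) = x) :
    ∑ I : Finset (Fin n), (1 + (ε - (I.card : ℝ) ^ 2 / (n : ℝ) ^ 2)) ^ m ≤
      Real.exp (1 + n * (d * ε / 2 + (x + d * x ^ 2 / 2))) := by
  have hnpos : (0 : ℝ) < n := by exact_mod_cast hn
  have hx0 : 0 < x := by rw [← hx]; exact Real.exp_pos _
  have hterm : ∀ I : Finset (Fin n), (1 + (ε - (I.card : ℝ) ^ 2 / (n : ℝ) ^ 2)) ^ m ≤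
      Real.exp (1 + n * (d * ε / 2 + d * x ^ 2 / 2)) * x ^ I.card := by
    intro I
    set k : ℝ := (I.card : ℝ) with hk
    have h1 : k ≤ n := by rw [hk]; exact_mod_cast card_finset_fin_le I
    have hk0 : 0 ≤ k := by positivity
    have h2 : k ^ 2 / (n : ℝ) ^ 2 ≤ 1 := by
      rw [div_le_one (by positivity)]
      gcongr
    have h3 : 0 ≤ k ^ 2 / (n : ℝ) ^ 2 := by positivity
    have h4 : 1 + (ε - k ^ 2 / (n : ℝ) ^ 2) ≤ Real.exp (ε - k ^ 2 / (n : ℝ) ^ 2) := by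
      linarith [Real.add_one_le_exp (ε - k ^ 2 / (n : ℝ) ^ 2)]
    have h5 : x ^ I.card = Real.exp (-(d * x) * k) := by
      conv_lhs => rw [← hx]
      rw [← Real.exp_nat_mul, mul_comm]
    refine (pow_le_pow_left₀ (by linarith) h4 m).trans ?_
    rw [h5, ← Real.exp_nat_mul, ← Real.exp_add, Real.exp_le_exp]
    -- Completing the square at k = xn bounds the quadratic below by a linear function of k, turning
    -- the sum over sets into (1 + x)^n. Replacing m by dn/2 costs at most k²/n² ≤ 1, the 1 in the
    -- exponent.
    have h6 : d * n / 2 * (k ^ 2 / (n : ℝ) ^ 2) = d * x * k - n * (d * x ^ 2 / 2) +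
        d * (k - x * n) ^ 2 / (2 * n) := by
      field_simp
      ring
    have h7 : 0 ≤ d * (k - x * n) ^ 2 / (2 * n) := by positivity
    nlinarith
  refine (Finset.sum_le_sum fun I _ => hterm I).trans ?_
  have h8 : ∑ I : Finset (Fin n), x ^ I.card = (x + 1) ^ n := by
    have := Finset.sum_pow_mul_eq_add_pow x 1 (Finset.univ : Finset (Fin n))
    simpa using this
  have h9 : (x + 1) ^ n ≤ Real.exp (n * x) := by
    rw [Real.exp_nat_mul]
    exact pow_le_pow_left₀ (by linarith) (Real.add_one_le_exp x) n
  rw [← Finset.mul_sum, h8]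
  refine (mul_le_mul_of_nonneg_left h9 (Real.exp_pos _).le).trans (le_of_eq ?_)
  rw [← Real.exp_add]
  congr 1
  ring

theorem exists_mem_logIndepDensities_le {d η : ℝ} (hd : 0 ≤ d) (hη : 0 < η) :
    ∃ y ∈ logIndepDensities d, y ≤ upperCurve d + η := by
  -- D comes first, making the error d²/D from saturated vertices at most η/2. Then n absorbs the
  -- rounding term 1, the diagonal term d/2 and the common-neighbour term dD²/2.
  obtain ⟨D, hD⟩ := exists_nat_gt (2 * d ^ 2 / η)
  have hDpos : (0 : ℝ) < D := lt_of_le_of_lt (by positivity) hD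
  obtain ⟨n, hn⟩ := exists_nat_gt (2 * (1 + d / 2 + d * D ^ 2 / 2) / η)
  have hnpos : (0 : ℝ) < n := lt_of_le_of_lt (by positivity) hn
  have hn' : 0 < n := by exact_mod_cast hnpos
  have hm : 2 * (⌊d * n / 2⌋₊ : ℝ) ≤ d * n := by
    linarith [Nat.floor_le (show 0 ≤ d * n / 2 by positivity)]
  have hm' : d * n ≤ 2 * (⌊d * n / 2⌋₊ + 1) := by linarith [Nat.lt_floor_add_one (d * n / 2)]
  obtain ⟨G, hG, hs, hi⟩ := exists_graph_numIndepSets_le hn' (by exact_mod_cast hDpos) hm rfl hd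
  have hle := hi.trans (sum_one_add_pow_le hn' hm hm' (by positivity) hd (exp_neg_mul_expNegW hd))
  have : Nonempty (Fin n) := ⟨⟨0, hn'⟩⟩
  refine ⟨_, ⟨Fin n, inferInstance, inferInstance, G, hG, ?_, rfl⟩, ?_⟩
  · rw [avgDegree_eq, Fintype.card_fin, div_le_iff₀ hnpos]
    refine le_trans ?_ hm
    exact_mod_cast hs
  · have hpos : (0 : ℝ) < numIndepSets G := by
      have : 0 < numIndepSets G := Finset.card_pos.2 ⟨∅, by simp [SimpleGraph.IsIndepSet]⟩
      exact_mod_cast this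
    rw [Fintype.card_fin, div_le_iff₀ hnpos]
    refine ((Real.log_le_iff_le_exp hpos).2 hle).trans ?_
    rw [upperCurve_eq hd]
    rw [div_lt_iff₀ hη] at hD hn
    have h1 : d ^ 2 / D ≤ η / 2 := by rw [div_le_iff₀ hDpos]; linarith
    have h2 : 1 + n * (d * (1 / n + 2 * d / D + (D : ℝ) ^ 2 / n) / 2 +
        (expNegW d + d * expNegW d ^ 2 / 2)) = (1 + d / 2 + d * D ^ 2 / 2) +
        n * (d ^ 2 / D) + n * (expNegW d + d * expNegW d ^ 2 / 2) := by
      field_simp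
      ring
    rw [h2]
    nlinarith

theorem theorem1 :
    ContinuousOn lowerCurve (Set.Ici 0) ∧ ContinuousOn upperCurve (Set.Ici 0) ∧
      ∀ d : ℝ, 0 ≤ d → lowerCurve d ≤ extremalF d ∧ extremalF d ≤ upperCurve d := by
  refine ⟨continuousOn_lowerCurve, continuousOn_upperCurve, fun d hd => ⟨?_, ?_⟩⟩
  · exact le_csInf (logIndepDensities_nonempty hd) fun x hx => lowerCurve_le_of_mem hd hx
  · refine le_of_forall_pos_le_add fun η hη => ?_
    obtain ⟨y, hy, hle⟩ := exists_mem_logIndepDensities_le hd hη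
    exact (csInf_le ⟨0, fun x hx => logIndepDensities_nonneg hx⟩ hy).trans hle
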